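/- Let $T\subseteq\mathbb{R}^n$ be a polyhedral cone, i.e. an intersection of finitely many closed half-spaces $\{y : a\cdot y\ge 0\}$. Let $T^1,\dots,T^\ell$ be its facets, i.e. its $(n-1)$-dimensional faces $T^i=\{y\in T : s^i\cdot y=0\}$, with inward unit normals $s^i$: $\|s^i\|=1$, $s^i\cdot y\ge 0$ for all $y\in T$, and $s^i\cdot y>0$ for some $y\in T$. Let $\gamma$ be the standard Gaussian measure on $\mathbb{R}^n$, $g\sim\mathcal N(0,I_n)$, and for a cone $V\subseteq\mathbb{R}^n$ let $\gamma_{\mathrm{rel}}(V):=\mathbb{P}(\mathrm{proj}_{\mathrm{span}(V)}\,g\in V)$. With $x_+:=\max(0,x)$, put for $w\in\mathbb{R}^n$ $$F(T,w):=\frac{1}{\sqrt{2\pi}}\sum_{i=1}^{\ell}\gamma_{\mathrm{rel}}(T^i)\,(s^i\cdot w)_+ .$$ Then for every $w\in\mathbb{R}^n$ $$\gamma\big(T\setminus[T+w]\big)\le 2F(T,w)\exp\big(\sqrt{n-1}\,\|w\|\big),$$ and if $w\in T$, then $$\gamma\big(T\setminus[T+w]\big)\ge F(T,w)\exp\big(-\sqrt{n-1}\,\|w\|-\tfrac12\|w\|^2\big).$$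 -/

import Mathlib

open ProbabilityTheory MeasureTheory
open scoped Pointwise RealInnerProductSpace

/-- The facet candidate `{y ∈ T | s · y = 0}` cut out of `T` by the normal vector `s`. -/
def coneFacet {n : ℕ} (T : Set (EuclideanSpace ℝ (Fin n))) (s : EuclideanSpace ℝ (Fin n)) :
    Set (EuclideanSpace ℝ (Fin n)) :=
  {y | y ∈ T ∧ ⟪s, y⟫ = 0}

/-- The inward unit normals of the facets of a cone `T ⊆ ℝⁿ`: unit vectors `s` such that `T` lies in
the half-space `{y | 0 ≤ s · y}` but not in its boundary, and such that the face
`{y ∈ T | s · y = 0}` is `(n - 1)`-dimensional. (The affine hull of a face of a cone is its linear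
span, since the face contains `0`.) -/
def facetNormals {n : ℕ} (T : Set (EuclideanSpace ℝ (Fin n))) :
    Set (EuclideanSpace ℝ (Fin n)) :=
  {s | ‖s‖ = 1 ∧ (∀ y ∈ T, 0 ≤ ⟪s, y⟫) ∧ (∃ y ∈ T, 0 < ⟪s, y⟫) ∧
    Module.finrank ℝ (Submodule.span ℝ (coneFacet T s)) + 1 = n}

/-- The standard Gaussian measure `γ(B) = ℙ(g ∈ B)`, `g ∼ N(0, Iₙ)`, as a real number. -/
noncomputable def gaussianMeas {n : ℕ} (B : Set (EuclideanSpace ℝ (Fin n))) : ℝ :=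
  (stdGaussian (EuclideanSpace ℝ (Fin n))).real B

/-- The relative Gaussian measure `γ_rel(T) = ℙ(proj_{span T} g ∈ T)`, `g ∼ N(0, Iₙ)`. -/
noncomputable def relGaussianMeas {n : ℕ} (T : Set (EuclideanSpace ℝ (Fin n))) : ℝ :=
  gaussianMeas {g | (Submodule.span ℝ T).starProjection g ∈ T}

/-- The margin `M(T, w) = T \ [T + w]`. -/
def margin {n : ℕ} (T : Set (EuclideanSpace ℝ (Fin n))) (w : EuclideanSpace ℝ (Fin n)) :
    Set (EuclideanSpace ℝ (Fin n)) :=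
  T \ (T + {w})

/-- `F(T, w) = (√(2π))⁻¹ ∑ᵢ γ_rel(Tⁱ) (sⁱ · w)₊`, where `s` lists the facet normals of `T` and
`Tⁱ = {y ∈ T | sⁱ · y = 0}`. -/
noncomputable def marginFunctional {n ℓ : ℕ} (T : Set (EuclideanSpace ℝ (Fin n)))
    (s : Fin ℓ → EuclideanSpace ℝ (Fin n)) (w : EuclideanSpace ℝ (Fin n)) : ℝ :=
  (√(2 * Real.pi))⁻¹ * ∑ i, relGaussianMeas (coneFacet T (s i)) * max 0 ⟪s i, w⟫

/-! ### Gaussian density and the effect of translating a cone -/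

section GaussianShift

variable {E : Type*} [NormedAddCommGroup E] [InnerProductSpace ℝ E] [FiniteDimensional ℝ E]
  [MeasurableSpace E] [BorelSpace E]

/-! From a point of the margin `T \ (T + w)`, travel in direction `-w`. The path leaves `T` before
time 1, through a face whose normal `s` has `s · w > 0`. So the margin is covered by the regions
swept by such faces along `[0, w)`, and faces that are not facets contribute only null sets
(`exists_mem_sweep_of_mem_margin`, `stdGaussian_inter_sweep_eq_zero`). If `w ∈ T`, the swept regions
of facets lie inside the margin and overlap in null sets (`sweep_subset_margin`,
`stdGaussian_sweep_inter_sweep`). Both bounds thus reduce to the measure of one swept facet.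

Slice that region orthogonally to `s`. The slice at height `z ∈ [0, s · w)` is the facet translated
inside the hyperplane by a vector of norm at most `‖w‖`. The heights contribute about `(s · w) /
√(2π)`. Translating a cone in dimension `m = n - 1` by `v` changes its Gaussian measure by a factor
between `exp (-√m ‖v‖ - ‖v‖² / 2)` and `exp (√m ‖v‖)` (`le_stdGaussian_cone_shift`,
`stdGaussian_cone_shift_le`). -/

theorem integrable_exp_neg_half_sq_norm :
    Integrable (fun x : E ↦ Real.exp (-(1 / 2) * ‖x‖ ^ 2)) := by
  have h := (GaussianFourier.integrable_cexp_neg_mul_sq_norm_add (V := E) (b := (1 / 2 : ℂ))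
    (by norm_num) 0 0).norm
  refine h.congr (ae_of_all _ fun x ↦ ?_)
  simp only [Complex.norm_exp, zero_mul, add_zero]
  congr 1
  have : (-(1 / 2 : ℂ) * (‖x‖ : ℂ) ^ 2) = ((-(1 / 2) * ‖x‖ ^ 2 : ℝ) : ℂ) := by push_cast; ring
  rw [this, Complex.ofReal_re]

/-- The standard Gaussian measure has density proportional to `exp (-‖x‖² / 2)`. -/
theorem stdGaussian_eq_withDensity :
    stdGaussian E = ENNReal.ofReal ((2 * Real.pi) ^ (Module.finrank ℝ E / 2 : ℝ))⁻¹ •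
      volume.withDensity (fun x : E ↦ ENNReal.ofReal (Real.exp (-(1 / 2) * ‖x‖ ^ 2))) := by
  have hfin : IsFiniteMeasure
      (volume.withDensity (fun x : E ↦ ENNReal.ofReal (Real.exp (-(1 / 2) * ‖x‖ ^ 2)))) :=
    isFiniteMeasure_withDensity_ofReal integrable_exp_neg_half_sq_norm.2
  have := Measure.smul_finite
    (volume.withDensity (fun x : E ↦ ENNReal.ofReal (Real.exp (-(1 / 2) * ‖x‖ ^ 2))))
    (c := ENNReal.ofReal ((2 * Real.pi) ^ (Module.finrank ℝ E / 2 : ℝ))⁻¹) ENNReal.ofReal_ne_top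
  refine Measure.ext_of_charFun ?_
  ext t
  have hpos : 0 < (2 * Real.pi) ^ (Module.finrank ℝ E / 2 : ℝ) := by positivity
  rw [charFun_stdGaussian, charFun_apply, integral_smul_measure,
    integral_withDensity_eq_integral_toReal_smul (by fun_prop) (by simp)]
  have h1 : ∀ x : E, (ENNReal.ofReal (Real.exp (-(1 / 2) * ‖x‖ ^ 2))).toReal •
      Complex.exp (⟪x, t⟫ * Complex.I) =
      Complex.exp (-(1 / 2 : ℂ) * ‖x‖ ^ 2 + Complex.I * ⟪t, x⟫) := by
    intro x
    rw [ENNReal.toReal_ofReal (Real.exp_pos _).le, Complex.exp_add, Complex.real_smul,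
      Complex.ofReal_exp, real_inner_comm]
    push_cast
    congr 2
    ring
  simp_rw [h1]
  rw [GaussianFourier.integral_cexp_neg_mul_sq_norm_add (by norm_num),
    ENNReal.toReal_ofReal (by positivity), Complex.real_smul]
  have h2 : (Real.pi / (1 / 2) : ℂ) ^ (Module.finrank ℝ E / 2 : ℂ) =
      (((2 * Real.pi) ^ (Module.finrank ℝ E / 2 : ℝ) : ℝ) : ℂ) := by
    rw [Complex.ofReal_cpow (by positivity)]
    push_cast
    congr 1
    ring
  rw [h2, ← mul_assoc, ← Complex.ofReal_mul, inv_mul_cancel₀ hpos.ne', Complex.ofReal_one, one_mul]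
  congr 1
  rw [Complex.I_sq]
  ring

theorem stdGaussian_absolutelyContinuous : stdGaussian E ≪ volume := by
  rw [stdGaussian_eq_withDensity]
  exact (withDensity_absolutelyContinuous _ _).smul_left _

theorem stdGaussian_submodule {p : Submodule ℝ E} (hp : p ≠ ⊤) : stdGaussian E p = 0 :=
  stdGaussian_absolutelyContinuous (Measure.addHaar_submodule _ _ hp)

theorem stdGaussian_hyperplane {a : E} (ha : a ≠ 0) : stdGaussian E {x | ⟪a, x⟫ = 0} = 0 := by
  have h : {x : E | ⟪a, x⟫ = 0} = ((ℝ ∙ a)ᗮ : Submodule ℝ E) := by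
    ext x
    simp [Submodule.mem_orthogonal_singleton_iff_inner_right]
  rw [h]
  refine stdGaussian_submodule fun h ↦ ha ?_
  have : a ∈ (ℝ ∙ a)ᗮ := h ▸ Submodule.mem_top
  exact inner_self_eq_zero.1 (Submodule.mem_orthogonal_singleton_iff_inner_right.1 this)

/-- Rescaling a Gaussian integral over a scaling-invariant set. -/
theorem setLIntegral_exp_neg_sq_norm_cone {D : Set E} (hD : MeasurableSet D)
    (hcone : ∀ c : ℝ, 0 < c → ∀ x ∈ D, c • x ∈ D) {r : ℝ} (hr : 0 < r) :
    ∫⁻ x in D, ENNReal.ofReal (Real.exp (-(1 / 2) * (r ^ 2 * ‖x‖ ^ 2))) =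
      ENNReal.ofReal (r ^ Module.finrank ℝ E)⁻¹ *
        ∫⁻ x in D, ENNReal.ofReal (Real.exp (-(1 / 2) * ‖x‖ ^ 2)) := by
  have hmem : ∀ x : E, r • x ∈ D ↔ x ∈ D := fun x ↦
    ⟨fun h ↦ by simpa [smul_smul, hr.ne'] using hcone r⁻¹ (inv_pos.2 hr) _ h, hcone r hr x⟩
  rw [← lintegral_indicator hD, ← lintegral_indicator hD]
  set F : E → ENNReal := D.indicator fun x ↦ ENNReal.ofReal (Real.exp (-(1 / 2) * ‖x‖ ^ 2))
  have hF : Measurable F := Measurable.indicator (by fun_prop) hD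
  have h1 : (D.indicator fun x ↦ ENNReal.ofReal (Real.exp (-(1 / 2) * (r ^ 2 * ‖x‖ ^ 2)))) =
      fun x ↦ F (r • x) := by
    ext x
    by_cases hx : x ∈ D
    · simp [F, hx, (hmem x).2 hx, norm_smul, mul_pow]
    · simp [F, hx, mt (hmem x).1 hx]
  rw [h1, ← lintegral_map hF (by fun_prop : Measurable fun x : E ↦ r • x),
    Measure.map_addHaar_smul _ hr.ne', lintegral_smul_measure, abs_of_pos (by positivity),
    smul_eq_mul]

theorem stdGaussian_shift {D : Set E} (hD : MeasurableSet D) (v : E) :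
    stdGaussian E {x | x - v ∈ D} =
      ENNReal.ofReal ((2 * Real.pi) ^ (Module.finrank ℝ E / 2 : ℝ))⁻¹ *
        ∫⁻ x in D, ENNReal.ofReal (Real.exp (-(1 / 2) * ‖x + v‖ ^ 2)) := by
  have hm : MeasurableSet {x | x - v ∈ D} := hD.preimage (by fun_prop)
  rw [stdGaussian_eq_withDensity, Measure.smul_apply, withDensity_apply _ hm, smul_eq_mul,
    ← lintegral_indicator hm, ← lintegral_indicator hD, ← lintegral_add_right_eq_self _ v]
  congr 2
  ext x
  have hx : x + v ∈ {x | x - v ∈ D} ↔ x ∈ D := by simp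
  by_cases h : x ∈ D
  · rw [Set.indicator_of_mem h, Set.indicator_of_mem (hx.2 h)]
  · rw [Set.indicator_of_notMem h, Set.indicator_of_notMem (mt hx.1 h)]

theorem stdGaussian_eq_mul_lintegral {D : Set E} (hD : MeasurableSet D) :
    stdGaussian E D = ENNReal.ofReal ((2 * Real.pi) ^ (Module.finrank ℝ E / 2 : ℝ))⁻¹ *
        ∫⁻ x in D, ENNReal.ofReal (Real.exp (-(1 / 2) * ‖x‖ ^ 2)) := by
  simpa using stdGaussian_shift hD 0

/-- This is the Jacobian cost of the dilation used in both shift estimates; it comes from `1 + x ≤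
exp x`. -/
theorem sqrt_one_add_div_sqrt_pow_le {m : ℕ} (hm : m ≠ 0) {b : ℝ} (hb : 0 ≤ b) :
    √(1 + b / √m) ^ m ≤ Real.exp (√m * b / 2) := by
  have hm' : (0 : ℝ) < m := by positivity
  have hs : 0 < √(m : ℝ) := Real.sqrt_pos.2 hm'
  have h1 : √(1 + b / √m) ≤ Real.exp (b / √m / 2) := by
    rw [Real.sqrt_le_left (Real.exp_pos _).le, ← Real.exp_nat_mul]
    have := Real.add_one_le_exp (b / √m)
    convert! (add_comm _ _).trans_le this using 2
    push_cast; ring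
  calc √(1 + b / √m) ^ m ≤ Real.exp (b / √m / 2) ^ m := by gcongr
    _ = Real.exp (√m * b / 2) := by
      rw [← Real.exp_nat_mul]
      congr 1
      have := Real.mul_self_sqrt hm'.le
      field_simp
      linear_combination (-b) * this

/-- The cross term `‖v‖ ‖x‖` is absorbed into a slightly wider Gaussian by completing a square.
Since `D` is invariant under dilation, the wider Gaussian rescales back to the standard one. Each of
the two operations costs `exp (√m ‖v‖ / 2)`. -/
theorem stdGaussian_cone_shift_le {D : Set E} (hD : MeasurableSet D)
    (hcone : ∀ c : ℝ, 0 < c → ∀ x ∈ D, c • x ∈ D) (v : E) :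
    stdGaussian E {x | x - v ∈ D} ≤
      ENNReal.ofReal (Real.exp (√(Module.finrank ℝ E) * ‖v‖)) * stdGaussian E D := by
  rcases eq_or_ne (Module.finrank ℝ E) 0 with hm | hm
  · have : Subsingleton E := Module.finrank_zero_iff.1 hm
    simp [Subsingleton.elim v 0]
  set m := Module.finrank ℝ E
  set b := ‖v‖
  have hb : 0 ≤ b := norm_nonneg v
  have hs : 0 < √(m : ℝ) := Real.sqrt_pos.2 (by positivity)
  set p := √(1 + b / √m)
  have hp2 : p ^ 2 = 1 + b / √m := Real.sq_sqrt (by positivity)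
  have hp : 0 < p := Real.sqrt_pos.2 (by positivity)
  have hpm := sqrt_one_add_div_sqrt_pow_le hm hb
  have key : ∫⁻ x in D, ENNReal.ofReal (Real.exp (-(1 / 2) * ‖x + v‖ ^ 2)) ≤
      ENNReal.ofReal (Real.exp (√m * b / 2)) *
        ∫⁻ x in D, ENNReal.ofReal (Real.exp (-(1 / 2) * (p⁻¹ ^ 2 * ‖x‖ ^ 2))) := by
    rw [← lintegral_const_mul _ (by fun_prop)]
    refine lintegral_mono fun x ↦ ?_
    rw [← ENNReal.ofReal_mul (Real.exp_pos _).le, ← Real.exp_add]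
    refine ENNReal.ofReal_le_ofReal (Real.exp_le_exp.2 ?_)
    have h1 : (‖x‖ - b) ^ 2 ≤ ‖x + v‖ ^ 2 := by
      rw [sq_le_sq, abs_of_nonneg (norm_nonneg (x + v))]
      simpa using abs_norm_sub_norm_le x (-v)
    have h2 : p⁻¹ ^ 2 = √m / (√m + b) := by
      rw [inv_pow, hp2]; field_simp
    -- The square vanishes at `‖x‖ = √m + b`. The surplus `b² / 2` cancels the `-b² / 2` from
    -- expanding `-(‖x‖ - b)² / 2`.
    have h3 : b * ‖x‖ ≤ (1 - √m / (√m + b)) * ‖x‖ ^ 2 / 2 + b * (√m + b) / 2 := by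
      have : (1 - √m / (√m + b)) * ‖x‖ ^ 2 / 2 + b * (√m + b) / 2 - b * ‖x‖ =
          b / (√m + b) / 2 * (‖x‖ - (√m + b)) ^ 2 := by
        have : √(m : ℝ) + b ≠ 0 := by positivity
        field_simp
        ring
      have : 0 ≤ b / (√m + b) / 2 * (‖x‖ - (√m + b)) ^ 2 := by positivity
      linarith
    rw [h2]
    linarith
  rw [stdGaussian_shift hD, stdGaussian_eq_mul_lintegral hD, mul_left_comm]
  gcongr
  refine key.trans ?_
  rw [setLIntegral_exp_neg_sq_norm_cone hD hcone (inv_pos.2 hp), ← mul_assoc]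
  gcongr
  rw [← ENNReal.ofReal_mul (Real.exp_pos _).le]
  refine ENNReal.ofReal_le_ofReal ?_
  rw [inv_pow, inv_inv]
  calc _ ≤ Real.exp (√m * b / 2) * Real.exp (√m * b / 2) := by gcongr
    _ = _ := by rw [← Real.exp_add]; ring_nf

/-- The same scheme with a narrower Gaussian. The term `-b² / 2` has nothing to cancel it here and
survives in the bound. -/
theorem le_stdGaussian_cone_shift {D : Set E} (hD : MeasurableSet D)
    (hcone : ∀ c : ℝ, 0 < c → ∀ x ∈ D, c • x ∈ D) (v : E) :
    ENNReal.ofReal (Real.exp (-√(Module.finrank ℝ E) * ‖v‖ - 1 / 2 * ‖v‖ ^ 2)) *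
      stdGaussian E D ≤ stdGaussian E {x | x - v ∈ D} := by
  rcases eq_or_ne (Module.finrank ℝ E) 0 with hm | hm
  · have : Subsingleton E := Module.finrank_zero_iff.1 hm
    simp [Subsingleton.elim v 0]
  set m := Module.finrank ℝ E
  set b := ‖v‖
  have hb : 0 ≤ b := norm_nonneg v
  have hs : 0 < √(m : ℝ) := Real.sqrt_pos.2 (by positivity)
  set p := √(1 + b / √m)
  have hp2 : p ^ 2 = 1 + b / √m := Real.sq_sqrt (by positivity)
  have hp : 0 < p := Real.sqrt_pos.2 (by positivity)
  have hpm := sqrt_one_add_div_sqrt_pow_le hm hb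
  have key : ENNReal.ofReal (Real.exp (-(√m * b / 2) - 1 / 2 * b ^ 2)) *
        ∫⁻ x in D, ENNReal.ofReal (Real.exp (-(1 / 2) * (p ^ 2 * ‖x‖ ^ 2))) ≤
      ∫⁻ x in D, ENNReal.ofReal (Real.exp (-(1 / 2) * ‖x + v‖ ^ 2)) := by
    rw [← lintegral_const_mul _ (by fun_prop)]
    refine lintegral_mono fun x ↦ ?_
    rw [← ENNReal.ofReal_mul (Real.exp_pos _).le, ← Real.exp_add]
    refine ENNReal.ofReal_le_ofReal (Real.exp_le_exp.2 ?_)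
    have h1 : ‖x + v‖ ^ 2 ≤ (‖x‖ + b) ^ 2 := by
      gcongr
      exact norm_add_le x v
    have h3 : b * ‖x‖ ≤ (b / √m) * ‖x‖ ^ 2 / 2 + b * √m / 2 := by
      have : (b / √m) * ‖x‖ ^ 2 / 2 + b * √m / 2 - b * ‖x‖ = b / √m / 2 * (‖x‖ - √m) ^ 2 := by
        field_simp
        ring
      have : 0 ≤ b / √m / 2 * (‖x‖ - √m) ^ 2 := by positivity
      linarith
    rw [hp2]
    linarith
  rw [stdGaussian_shift hD, stdGaussian_eq_mul_lintegral hD, mul_left_comm]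
  gcongr
  refine le_trans ?_ key
  rw [setLIntegral_exp_neg_sq_norm_cone hD hcone hp, ← mul_assoc]
  gcongr
  rw [← ENNReal.ofReal_mul (Real.exp_pos _).le]
  refine ENNReal.ofReal_le_ofReal ?_
  calc _ = Real.exp (-(√m * b / 2) - 1 / 2 * b ^ 2) * (Real.exp (√m * b / 2))⁻¹ := by
        rw [← Real.exp_neg, ← Real.exp_add]; ring_nf
    _ ≤ _ := by gcongr

end GaussianShift

/-! ### Gaussian measure of a region swept by a cone in a hyperplane -/

section Sweep

variable {E : Type*} [NormedAddCommGroup E] [InnerProductSpace ℝ E]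

theorem inner_coe_orthogonal_singleton (s : E) (x : (ℝ ∙ s)ᗮ) : ⟪s, (x : E)⟫ = 0 :=
  Submodule.mem_orthogonal_singleton_iff_inner_right.1 x.2

theorem exists_eq_smul_add_orthogonal {s : E} (hs : ‖s‖ = 1) (w : E) :
    ∃ u : (ℝ ∙ s)ᗮ, w = ⟪s, w⟫ • s + (u : E) :=
  ⟨⟨w - ⟪s, w⟫ • s, by
    rw [Submodule.mem_orthogonal_singleton_iff_inner_right, inner_sub_right, inner_smul_right,
      real_inner_self_eq_norm_sq, hs]
    ring⟩, by simp⟩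

theorem norm_sq_smul_add_orthogonal {s : E} (hs : ‖s‖ = 1) (k : ℝ) (u : (ℝ ∙ s)ᗮ) :
    ‖k • s + (u : E)‖ ^ 2 = k ^ 2 + ‖u‖ ^ 2 := by
  rw [norm_add_sq_real, inner_smul_left, inner_coe_orthogonal_singleton, norm_smul, hs]
  simp

/-- The region swept out by `C` when it is translated along the half-open segment `[0, w)`. -/
def sweep (C : Set E) (w : E) : Set E := {y | ∃ t ∈ Set.Ico (0 : ℝ) 1, y - t • w ∈ C}

/-- As `C` lies in the hyperplane orthogonal to `s`, the height of `y` determines the time `t`. This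
removes the existential, giving measurability and explicit slices. -/
theorem mem_sweep_iff {C : Set E} {s w : E} (hC : ∀ y ∈ C, ⟪s, y⟫ = 0) (hw : 0 < ⟪s, w⟫) (y : E) :
    y ∈ sweep C w ↔ ⟪s, y⟫ ∈ Set.Ico 0 ⟪s, w⟫ ∧ y - (⟪s, y⟫ / ⟪s, w⟫) • w ∈ C := by
  constructor
  · rintro ⟨t, ht, hy⟩
    have h := hC _ hy
    rw [inner_sub_right, inner_smul_right, sub_eq_zero] at h
    have h' : ⟪s, y⟫ / ⟪s, w⟫ = t := by rw [h]; field_simp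
    refine ⟨⟨?_, ?_⟩, h' ▸ hy⟩
    · rw [h]; exact mul_nonneg ht.1 hw.le
    · rw [h]; nlinarith [ht.2]
  · rintro ⟨⟨h0, h1⟩, hy⟩
    exact ⟨_, ⟨div_nonneg h0 hw.le, (div_lt_one hw).2 h1⟩, hy⟩

variable [FiniteDimensional ℝ E] [MeasurableSpace E] [BorelSpace E]

/-- The standard Gaussian splits as the independent sum of its component along a unit vector and
its component in the orthogonal hyperplane. -/
theorem map_prod_orthogonal_eq_stdGaussian {s : E} (hs : ‖s‖ = 1) :
    ((gaussianReal 0 1).prod (stdGaussian (ℝ ∙ s)ᗮ)).map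
      (fun p : ℝ × (ℝ ∙ s)ᗮ ↦ p.1 • s + (p.2 : E)) = stdGaussian E := by
  have hmeas : Measurable fun p : ℝ × (ℝ ∙ s)ᗮ ↦ p.1 • s + (p.2 : E) := by fun_prop
  have := Measure.isProbabilityMeasure_map hmeas.aemeasurable
    (μ := (gaussianReal 0 1).prod (stdGaussian (ℝ ∙ s)ᗮ))
  refine Measure.ext_of_charFun ?_
  ext t
  obtain ⟨u, hu⟩ := exists_eq_smul_add_orthogonal hs t
  set k := ⟪s, t⟫
  rw [charFun_stdGaussian, charFun_apply, integral_map hmeas.aemeasurable (by fun_prop)]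
  have h1 : ∀ p : ℝ × (ℝ ∙ s)ᗮ, Complex.exp (⟪p.1 • s + (p.2 : E), t⟫ * Complex.I) =
      Complex.exp (⟪p.1, k⟫ * Complex.I) * Complex.exp (⟪p.2, u⟫ * Complex.I) := by
    intro p
    have : ⟪p.1 • s + (p.2 : E), t⟫ = ⟪p.1, k⟫ + ⟪p.2, u⟫ := by
      rw [inner_add_left, inner_smul_left, hu, inner_add_right (p.2 : E), inner_smul_right,
        real_inner_comm s (p.2 : E), inner_coe_orthogonal_singleton, ← hu]
      simp [k, mul_comm]
    rw [← Complex.exp_add, this]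
    push_cast
    ring_nf
  simp_rw [h1]
  rw [integral_prod_mul (fun z : ℝ ↦ Complex.exp (⟪z, k⟫ * Complex.I))
    (fun x : (ℝ ∙ s)ᗮ ↦ Complex.exp (⟪x, u⟫ * Complex.I)), ← charFun_apply, ← charFun_apply,
    charFun_gaussianReal, charFun_stdGaussian, ← Complex.exp_add]
  congr 1
  have h2 := norm_sq_smul_add_orthogonal hs k u
  rw [← hu] at h2
  rw [← Complex.ofReal_pow ‖t‖, h2]
  push_cast
  simp only [mul_zero, zero_mul, one_mul, zero_sub]
  ring

theorem measurableSet_sweep {C : Set E} (hCm : MeasurableSet C) {s w : E}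
    (hC : ∀ y ∈ C, ⟪s, y⟫ = 0) (hw : 0 < ⟪s, w⟫) : MeasurableSet (sweep C w) := by
  have : sweep C w = (fun y ↦ ⟪s, y⟫) ⁻¹' Set.Ico 0 ⟪s, w⟫ ∩
      (fun y ↦ y - (⟪s, y⟫ / ⟪s, w⟫) • w) ⁻¹' C := by
    ext y; exact mem_sweep_iff hC hw y
  rw [this]
  exact (measurableSet_Ico.preimage (by fun_prop)).inter (hCm.preimage (by fun_prop))

/-- Tonelli over the height `z` along `s`; each slice is `C` translated by a fraction of the
orthogonal component `u` of `w`. -/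
theorem stdGaussian_sweep {C : Set E} (hCm : MeasurableSet C) {s w : E} (hs : ‖s‖ = 1)
    (hC : ∀ y ∈ C, ⟪s, y⟫ = 0) (hw : 0 < ⟪s, w⟫) {u : (ℝ ∙ s)ᗮ} (hu : w = ⟪s, w⟫ • s + (u : E)) :
    stdGaussian E (sweep C w) = ∫⁻ z in Set.Ico 0 ⟪s, w⟫,
      stdGaussian (ℝ ∙ s)ᗮ {x | x - (z / ⟪s, w⟫) • u ∈ {x : (ℝ ∙ s)ᗮ | (x : E) ∈ C}}
        ∂(gaussianReal 0 1) := by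
  have hmeas : Measurable fun p : ℝ × (ℝ ∙ s)ᗮ ↦ p.1 • s + (p.2 : E) := by fun_prop
  have hSm := measurableSet_sweep hCm hC hw
  rw [← map_prod_orthogonal_eq_stdGaussian hs, Measure.map_apply hmeas hSm,
    Measure.prod_apply (hmeas hSm), ← lintegral_indicator measurableSet_Ico]
  congr 1
  ext z
  have hmem : ∀ x : (ℝ ∙ s)ᗮ, z • s + (x : E) ∈ sweep C w ↔
      z ∈ Set.Ico 0 ⟪s, w⟫ ∧ ((x - (z / ⟪s, w⟫) • u : (ℝ ∙ s)ᗮ) : E) ∈ C := by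
    intro x
    have h1 : ⟪s, z • s + (x : E)⟫ = z := by
      rw [inner_add_right, inner_smul_right, real_inner_self_eq_norm_sq, hs,
        inner_coe_orthogonal_singleton]
      simp
    have h2 : z • s + (x : E) - (z / ⟪s, w⟫) • w = ((x - (z / ⟪s, w⟫) • u : (ℝ ∙ s)ᗮ) : E) := by
      have : (z / ⟪s, w⟫) • w = z • s + (z / ⟪s, w⟫) • (u : E) := by
        refine (congrArg (fun y ↦ (z / ⟪s, w⟫) • y) hu).trans ?_
        simp only [smul_add, smul_smul, div_mul_cancel₀ _ hw.ne']
      rw [this]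
      push_cast
      abel
    rw [mem_sweep_iff hC hw, h1, h2]
  by_cases hz : z ∈ Set.Ico 0 ⟪s, w⟫
  · rw [Set.indicator_of_mem hz]
    congr 1
    ext x
    exact (hmem x).trans (and_iff_right hz)
  · rw [Set.indicator_of_notMem hz]
    convert! measure_empty (μ := stdGaussian (ℝ ∙ s)ᗮ)
    ext x
    exact iff_of_false (fun h ↦ hz ((hmem x).1 h).1) id

theorem gaussianReal_Ico_le (k : ℝ) :
    gaussianReal 0 1 (Set.Ico 0 k) ≤ ENNReal.ofReal ((√(2 * Real.pi))⁻¹ * k) := by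
  rw [gaussianReal_apply _ one_ne_zero, ENNReal.ofReal_mul (by positivity)]
  calc _ ≤ ∫⁻ _ in Set.Ico 0 k, ENNReal.ofReal (√(2 * Real.pi))⁻¹ := by
        refine lintegral_mono fun x ↦ ENNReal.ofReal_le_ofReal ?_
        rw [gaussianPDFReal]
        simp only [NNReal.coe_one, mul_one, sub_zero]
        refine mul_le_of_le_one_right (by positivity) (Real.exp_le_one_iff.2 ?_)
        have := sq_nonneg x
        linarith
    _ = _ := by simp

theorem le_gaussianReal_Ico (k : ℝ) :
    ENNReal.ofReal ((√(2 * Real.pi))⁻¹ * k * Real.exp (-(1 / 2) * k ^ 2)) ≤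
      gaussianReal 0 1 (Set.Ico 0 k) := by
  rw [gaussianReal_apply _ one_ne_zero, mul_right_comm, ENNReal.ofReal_mul (by positivity)]
  calc _ = ∫⁻ _ in Set.Ico 0 k,
          ENNReal.ofReal ((√(2 * Real.pi))⁻¹ * Real.exp (-(1 / 2) * k ^ 2)) := by simp
    _ ≤ _ := by
        refine setLIntegral_mono' measurableSet_Ico fun x hx ↦ ENNReal.ofReal_le_ofReal ?_
        rw [gaussianPDFReal]
        simp only [NNReal.coe_one, mul_one, sub_zero]
        gcongr
        have := pow_le_pow_left₀ hx.1 hx.2.le 2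
        linarith

theorem stdGaussian_sweep_le {C : Set E} (hCm : MeasurableSet C)
    (hcone : ∀ c : ℝ, 0 < c → ∀ x ∈ C, c • x ∈ C) {s w : E} (hs : ‖s‖ = 1)
    (hC : ∀ y ∈ C, ⟪s, y⟫ = 0) (hw : 0 < ⟪s, w⟫) :
    stdGaussian E (sweep C w) ≤ ENNReal.ofReal ((√(2 * Real.pi))⁻¹ * ⟪s, w⟫) *
      (ENNReal.ofReal (Real.exp (√(Module.finrank ℝ (ℝ ∙ s)ᗮ) * ‖w‖)) *
        stdGaussian (ℝ ∙ s)ᗮ {x | (x : E) ∈ C}) := by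
  obtain ⟨u, hu⟩ := exists_eq_smul_add_orthogonal hs w
  have hn := norm_sq_smul_add_orthogonal hs ⟪s, w⟫ u
  rw [← hu] at hn
  rw [stdGaussian_sweep hCm hs hC hw hu]
  have hD : MeasurableSet {x : (ℝ ∙ s)ᗮ | (x : E) ∈ C} := hCm.preimage (by fun_prop)
  calc _ ≤ ∫⁻ _ in Set.Ico 0 ⟪s, w⟫,
          ENNReal.ofReal (Real.exp (√(Module.finrank ℝ (ℝ ∙ s)ᗮ) * ‖w‖)) *
            stdGaussian (ℝ ∙ s)ᗮ {x | (x : E) ∈ C} ∂(gaussianReal 0 1) := by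
        refine setLIntegral_mono' measurableSet_Ico fun z hz ↦ ?_
        refine (stdGaussian_cone_shift_le hD (fun c hc x hx ↦ hcone c hc _ hx) _).trans ?_
        gcongr
        rw [norm_smul, Real.norm_of_nonneg (div_nonneg hz.1 hw.le)]
        calc _ ≤ 1 * ‖u‖ := by gcongr; exact ((div_lt_one hw).2 hz.2).le
          _ ≤ ‖w‖ := by
            rw [one_mul]
            exact le_of_sq_le_sq (by nlinarith) (norm_nonneg _)
    _ ≤ _ := by
        rw [setLIntegral_const, mul_comm]
        gcongr
        exact gaussianReal_Ico_le _

theorem le_stdGaussian_sweep {C : Set E} (hCm : MeasurableSet C)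
    (hcone : ∀ c : ℝ, 0 < c → ∀ x ∈ C, c • x ∈ C) {s w : E} (hs : ‖s‖ = 1)
    (hC : ∀ y ∈ C, ⟪s, y⟫ = 0) (hw : 0 < ⟪s, w⟫) :
    ENNReal.ofReal ((√(2 * Real.pi))⁻¹ * ⟪s, w⟫) *
      (ENNReal.ofReal (Real.exp (-√(Module.finrank ℝ (ℝ ∙ s)ᗮ) * ‖w‖ - 1 / 2 * ‖w‖ ^ 2)) *
        stdGaussian (ℝ ∙ s)ᗮ {x | (x : E) ∈ C}) ≤ stdGaussian E (sweep C w) := by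
  obtain ⟨u, hu⟩ := exists_eq_smul_add_orthogonal hs w
  have hn := norm_sq_smul_add_orthogonal hs ⟪s, w⟫ u
  rw [← hu] at hn
  have huw : ‖u‖ ≤ ‖w‖ := le_of_sq_le_sq (by nlinarith) (norm_nonneg _)
  rw [stdGaussian_sweep hCm hs hC hw hu]
  have hD : MeasurableSet {x : (ℝ ∙ s)ᗮ | (x : E) ∈ C} := hCm.preimage (by fun_prop)
  set m := Module.finrank ℝ (ℝ ∙ s)ᗮ
  calc _ ≤ ENNReal.ofReal (Real.exp (-√m * ‖u‖ - 1 / 2 * ‖u‖ ^ 2)) *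
            stdGaussian (ℝ ∙ s)ᗮ {x | (x : E) ∈ C} * gaussianReal 0 1 (Set.Ico 0 ⟪s, w⟫) := by
        refine le_trans ?_ (mul_le_mul_right (le_gaussianReal_Ico _) _)
        rw [← mul_assoc, ← ENNReal.ofReal_mul (by positivity), mul_right_comm (ENNReal.ofReal _),
          ← ENNReal.ofReal_mul (by positivity)]
        gcongr ?_ * _
        refine ENNReal.ofReal_le_ofReal ?_
        rw [mul_left_comm, ← Real.exp_add]
        gcongr
        -- The losses `⟪s, w⟫² / 2` from the height density and `‖u‖² / 2` from the shift add up to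
        -- `‖w‖² / 2` by Pythagoras (`hn`).
        nlinarith [mul_le_mul_of_nonneg_left huw (Real.sqrt_nonneg m)]
    _ = ∫⁻ _ in Set.Ico 0 ⟪s, w⟫, ENNReal.ofReal (Real.exp (-√m * ‖u‖ - 1 / 2 * ‖u‖ ^ 2)) *
            stdGaussian (ℝ ∙ s)ᗮ {x | (x : E) ∈ C} ∂(gaussianReal 0 1) := by
        rw [setLIntegral_const]
    _ ≤ _ := by
        refine setLIntegral_mono' measurableSet_Ico fun z hz ↦ ?_
        refine le_trans ?_ (le_stdGaussian_cone_shift hD (fun c hc x hx ↦ hcone c hc _ hx) _)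
        have hv : ‖(z / ⟪s, w⟫) • u‖ ≤ ‖u‖ := by
          rw [norm_smul, Real.norm_of_nonneg (div_nonneg hz.1 hw.le)]
          exact mul_le_of_le_one_left (norm_nonneg _) ((div_lt_one hw).2 hz.2).le
        have h1 := pow_le_pow_left₀ (norm_nonneg _) hv 2
        have h2 := mul_le_mul_of_nonneg_left hv (Real.sqrt_nonneg m)
        gcongr ?_ * _
        exact ENNReal.ofReal_le_ofReal (Real.exp_le_exp.2 (by linarith))

end Sweep

/-! ### Facets of a polyhedral cone and the geometry of the margin -/

section Cone

variable {n : ℕ}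

local notation "𝔼" n => EuclideanSpace ℝ (Fin n)

/-- The projection forgets the component along `s`, which integrates to 1. -/
theorem relGaussianMeas_eq_real {C : Set (𝔼 n)} (hCm : MeasurableSet C) {s : 𝔼 n} (hs : ‖s‖ = 1)
    (hspan : Submodule.span ℝ C = (ℝ ∙ s)ᗮ) :
    relGaussianMeas C = (stdGaussian (ℝ ∙ s)ᗮ).real {x | (x : 𝔼 n) ∈ C} := by
  have hmeas : Measurable fun p : ℝ × (ℝ ∙ s)ᗮ ↦ p.1 • s + (p.2 : 𝔼 n) := by fun_prop
  have hm : MeasurableSet {g | (ℝ ∙ s)ᗮ.starProjection g ∈ C} := hCm.preimage (by fun_prop)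
  have hpre : (fun p : ℝ × (ℝ ∙ s)ᗮ ↦ p.1 • s + (p.2 : 𝔼 n)) ⁻¹'
      {g | (ℝ ∙ s)ᗮ.starProjection g ∈ C} = Set.univ ×ˢ {x : (ℝ ∙ s)ᗮ | (x : 𝔼 n) ∈ C} := by
    ext ⟨z, x⟩
    have h1 : (ℝ ∙ s)ᗮ.starProjection s = 0 :=
      (Submodule.starProjection_apply_eq_zero_iff _).2
        (Submodule.le_orthogonal_orthogonal _ (Submodule.mem_span_singleton_self s))
    have h2 : (ℝ ∙ s)ᗮ.starProjection (x : 𝔼 n) = x := Submodule.starProjection_eq_self_iff.2 x.2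
    simp only [Set.mem_preimage, Set.mem_ofPred_eq, map_add, map_smul, h1, h2, smul_zero, zero_add,
      Set.mem_prod, Set.mem_univ, true_and]
  simp only [relGaussianMeas, gaussianMeas, hspan, measureReal_def]
  rw [← map_prod_orthogonal_eq_stdGaussian hs, Measure.map_apply hmeas hm, hpre,
    Measure.prod_prod, measure_univ, one_mul]

theorem finrank_orthogonal_singleton_add_one {s : 𝔼 n} (hs : ‖s‖ = 1) :
    Module.finrank ℝ (ℝ ∙ s)ᗮ + 1 = n := by
  have h := Submodule.finrank_add_finrank_orthogonal (ℝ ∙ s)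
  rw [finrank_span_singleton (norm_ne_zero_iff.1 (hs ▸ one_ne_zero)), finrank_euclideanSpace_fin]
    at h
  omega

theorem span_coneFacet_eq {T : Set (𝔼 n)} {s : 𝔼 n} (hs : s ∈ facetNormals T) :
    Submodule.span ℝ (coneFacet T s) = (ℝ ∙ s)ᗮ := by
  refine Submodule.eq_of_le_of_finrank_eq (Submodule.span_le.2 fun y hy ↦
    Submodule.mem_orthogonal_singleton_iff_inner_right.2 hy.2) ?_
  have := finrank_orthogonal_singleton_add_one hs.1
  have := hs.2.2.2
  omega

variable {T : PointedCone ℝ (𝔼 n)}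

theorem isClosed_of_dualFG (hT : T.DualFG (innerₗ (𝔼 n))) : IsClosed (T : Set (𝔼 n)) := by
  obtain ⟨A, rfl⟩ := hT
  have : ((PointedCone.dual (innerₗ (𝔼 n)) (A : Set (𝔼 n)) : PointedCone ℝ (𝔼 n)) : Set (𝔼 n)) =
      ⋂ a ∈ A, {y | 0 ≤ ⟪a, y⟫} := by
    ext y
    simp
  rw [this]
  exact isClosed_biInter fun a _ ↦ isClosed_le continuous_const (by fun_prop)

theorem measurableSet_coneFacet (hT : IsClosed (T : Set (𝔼 n))) (s : 𝔼 n) :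
    MeasurableSet (coneFacet (T : Set (𝔼 n)) s) :=
  (hT.inter (isClosed_eq (by fun_prop : Continuous fun y : 𝔼 n ↦ ⟪s, y⟫)
    continuous_const)).measurableSet

theorem smul_mem_coneFacet (s : 𝔼 n) (c : ℝ) (hc : 0 < c) :
    ∀ x ∈ coneFacet (T : Set (𝔼 n)) s, c • x ∈ coneFacet (T : Set (𝔼 n)) s := fun x hx ↦
  ⟨T.smul_mem hc.le hx.1, by rw [inner_smul_right, hx.2, mul_zero]⟩

theorem gaussianMeas_sweep_coneFacet_le (hT : IsClosed (T : Set (𝔼 n))) {s w : 𝔼 n}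
    (hs : s ∈ facetNormals (T : Set (𝔼 n))) (hw : 0 < ⟪s, w⟫) :
    gaussianMeas (sweep (coneFacet (T : Set (𝔼 n)) s) w) ≤ (√(2 * Real.pi))⁻¹ *
      (relGaussianMeas (coneFacet (T : Set (𝔼 n)) s) * ⟪s, w⟫) *
        Real.exp (√((n : ℝ) - 1) * ‖w‖) := by
  have hCm := measurableSet_coneFacet hT s
  have h := stdGaussian_sweep_le hCm (smul_mem_coneFacet s) hs.1 (fun y hy ↦ hy.2) hw
  have hn : ((n : ℝ) - 1) = (Module.finrank ℝ (ℝ ∙ s)ᗮ : ℝ) := by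
    rw [sub_eq_iff_eq_add]
    exact_mod_cast (finrank_orthogonal_singleton_add_one hs.1).symm
  rw [relGaussianMeas_eq_real hCm hs.1 (span_coneFacet_eq hs), hn]
  refine (ENNReal.toReal_mono (by finiteness) h).trans_eq ?_
  rw [ENNReal.toReal_mul, ENNReal.toReal_mul, ENNReal.toReal_ofReal (by positivity),
    ENNReal.toReal_ofReal (by positivity), measureReal_def]
  ring

theorem le_gaussianMeas_sweep_coneFacet (hT : IsClosed (T : Set (𝔼 n))) {s w : 𝔼 n}
    (hs : s ∈ facetNormals (T : Set (𝔼 n))) (hw : 0 < ⟪s, w⟫) :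
    (√(2 * Real.pi))⁻¹ * (relGaussianMeas (coneFacet (T : Set (𝔼 n)) s) * ⟪s, w⟫) *
        Real.exp (-√((n : ℝ) - 1) * ‖w‖ - 1 / 2 * ‖w‖ ^ 2) ≤
      gaussianMeas (sweep (coneFacet (T : Set (𝔼 n)) s) w) := by
  have hCm := measurableSet_coneFacet hT s
  have h := le_stdGaussian_sweep hCm (smul_mem_coneFacet s) hs.1 (fun y hy ↦ hy.2) hw
  have hn : ((n : ℝ) - 1) = (Module.finrank ℝ (ℝ ∙ s)ᗮ : ℝ) := by
    rw [sub_eq_iff_eq_add]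
    exact_mod_cast (finrank_orthogonal_singleton_add_one hs.1).symm
  rw [relGaussianMeas_eq_real hCm hs.1 (span_coneFacet_eq hs), hn]
  refine le_trans (le_of_eq ?_) (ENNReal.toReal_mono (by finiteness) h)
  rw [ENNReal.toReal_mul, ENNReal.toReal_mul, ENNReal.toReal_ofReal (by positivity),
    ENNReal.toReal_ofReal (by positivity), measureReal_def]
  ring

theorem mem_margin_iff {y w : 𝔼 n} :
    y ∈ margin (T : Set (𝔼 n)) w ↔ y ∈ T ∧ y - w ∉ T := by
  simp [margin, sub_eq_add_neg]

/-- Along `y - t • w`, only constraints with `⟪a, w⟫ > 0` decrease, and each becomes tight at `t =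
⟪a, y⟫ / ⟪a, w⟫`. The constraint attaining the smallest such time is the witness: all others still
hold then. -/
theorem exists_mem_sweep_of_mem_margin {A : Finset (𝔼 n)}
    (hA : PointedCone.dual (innerₗ (𝔼 n)) (A : Set (𝔼 n)) = T) {y w : 𝔼 n}
    (hy : y ∈ margin (T : Set (𝔼 n)) w) :
    ∃ a ∈ A, 0 < ⟪a, w⟫ ∧ y ∈ sweep (coneFacet (T : Set (𝔼 n)) a) w := by
  have hmem : ∀ z, z ∈ T ↔ ∀ a ∈ A, 0 ≤ ⟪a, z⟫ := by
    intro z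
    rw [← hA]
    simp
  obtain ⟨hyT, hyw⟩ := mem_margin_iff.1 hy
  rw [hmem] at hyT hyw
  push Not at hyw
  obtain ⟨b, hbA, hb⟩ := hyw
  rw [inner_sub_right, sub_neg] at hb
  have hbw : 0 < ⟪b, w⟫ := (hyT b hbA).trans_lt hb
  obtain ⟨a, ha, hmin⟩ := (A.filter fun a ↦ 0 < ⟪a, w⟫).exists_min_image
    (fun a ↦ ⟪a, y⟫ / ⟪a, w⟫) ⟨b, Finset.mem_filter.2 ⟨hbA, hbw⟩⟩
  obtain ⟨haA, haw⟩ := Finset.mem_filter.1 ha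
  have h0 : 0 ≤ ⟪a, y⟫ / ⟪a, w⟫ := div_nonneg (hyT a haA) haw.le
  refine ⟨a, haA, haw, ⟪a, y⟫ / ⟪a, w⟫, ⟨h0, ?_⟩, (hmem _).2 fun c hc ↦ ?_, ?_⟩
  -- The constraint `b` is already violated at `t = 1`, so the first exit time is below 1.
  · exact (hmin b (Finset.mem_filter.2 ⟨hbA, hbw⟩)).trans_lt ((div_lt_one hbw).2 hb)
  · rw [inner_sub_right, inner_smul_right, sub_nonneg]
    rcases lt_or_ge 0 ⟪c, w⟫ with hcw | hcw
    · exact (le_div_iff₀ hcw).1 (hmin c (Finset.mem_filter.2 ⟨hc, hcw⟩))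
    · exact (mul_nonpos_of_nonneg_of_nonpos h0 hcw).trans (hyT c hc)
  · rw [inner_sub_right, inner_smul_right, div_mul_cancel₀ _ haw.ne', sub_self]

/-- Unless the normalization of `a` is a facet normal, the set swept out of `T` by the face
orthogonal to `a` is negligible. -/
theorem stdGaussian_inter_sweep_eq_zero {A : Finset (𝔼 n)}
    (hA : PointedCone.dual (innerₗ (𝔼 n)) (A : Set (𝔼 n)) = T) {a w : 𝔼 n} (haA : a ∈ A)
    (haw : 0 < ⟪a, w⟫) (ha : ‖a‖⁻¹ • a ∉ facetNormals (T : Set (𝔼 n))) :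
    stdGaussian (𝔼 n) (T ∩ sweep (coneFacet (T : Set (𝔼 n)) a) w) = 0 := by
  have ha0 : a ≠ 0 := by rintro rfl; simp at haw
  have hnorm : 0 < ‖a‖ := norm_pos_iff.2 ha0
  have hs1 : ‖‖a‖⁻¹ • a‖ = 1 := norm_smul_inv_norm ha0
  have hnn : ∀ y ∈ T, 0 ≤ ⟪a, y⟫ := by
    intro y hy
    rw [← hA] at hy
    exact hy haA
  -- If `T` is not contained in the hyperplane of `a`, the face spans dimension at most `n - 2`, and
  -- adding the direction `w` still gives a proper subspace. Otherwise `T` itself is null, while the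
  -- sweep alone need not be; hence the intersection with `T`.
  by_cases hpos : ∃ y ∈ T, 0 < ⟪a, y⟫
  · have hF : coneFacet (T : Set (𝔼 n)) (‖a‖⁻¹ • a) = coneFacet (T : Set (𝔼 n)) a := by
      ext y
      simp [coneFacet, inner_smul_left, hnorm.ne']
    have hle : Submodule.span ℝ (coneFacet (T : Set (𝔼 n)) a) ≤ (ℝ ∙ (‖a‖⁻¹ • a))ᗮ := by
      rw [← hF]
      exact Submodule.span_le.2 fun y hy ↦
        Submodule.mem_orthogonal_singleton_iff_inner_right.2 hy.2
    have hdim : Module.finrank ℝ (Submodule.span ℝ (coneFacet (T : Set (𝔼 n)) a)) + 1 < n := by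
      have h1 := Submodule.finrank_mono hle
      have h2 := finrank_orthogonal_singleton_add_one hs1
      have h3 : Module.finrank ℝ (Submodule.span ℝ (coneFacet (T : Set (𝔼 n)) a)) + 1 ≠ n := by
        intro h
        refine ha ⟨hs1, fun y hy ↦ ?_, ?_, by rwa [hF]⟩
        · rw [real_inner_smul_left]
          exact mul_nonneg (inv_nonneg.2 hnorm.le) (hnn y hy)
        · obtain ⟨y, hy, hay⟩ := hpos
          exact ⟨y, hy, by rw [real_inner_smul_left]; exact mul_pos (inv_pos.2 hnorm) hay⟩
      omega
    refine measure_mono_null (t := (Submodule.span ℝ (coneFacet (T : Set (𝔼 n)) a) ⊔ ℝ ∙ w :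
      Submodule ℝ (𝔼 n))) ?_ (stdGaussian_submodule fun htop ↦ ?_)
    · rintro y ⟨-, t, -, ht⟩
      rw [← sub_add_cancel y (t • w)]
      exact Submodule.add_mem_sup (Submodule.subset_span ht)
        (Submodule.smul_mem _ _ (Submodule.mem_span_singleton_self w))
    · have h1 := Submodule.finrank_add_le_finrank_add_finrank
        (Submodule.span ℝ (coneFacet (T : Set (𝔼 n)) a)) (ℝ ∙ w)
      rw [htop, finrank_top, finrank_euclideanSpace_fin] at h1
      have h2 := finrank_span_le_card (R := ℝ) ({w} : Set (𝔼 n))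
      rw [Set.toFinset_singleton, Finset.card_singleton] at h2
      omega
  · push Not at hpos
    exact measure_mono_null (fun y hy ↦ le_antisymm (hpos y hy.1) (hnn y hy.1))
      (stdGaussian_hyperplane ha0)

/-- A common point reaches both faces at the same time `t`, since at each hitting time the other
inequality still holds. Hence `⟪s, y⟫ / ⟪s, w⟫ = ⟪s', y⟫ / ⟪s', w⟫`, a genuine hyperplane because
distinct unit vectors are not positive multiples of each other. -/
theorem stdGaussian_sweep_inter_sweep {T : Set (𝔼 n)} {s s' w : 𝔼 n} (hs : ‖s‖ = 1)
    (hs' : ‖s'‖ = 1) (hne : s ≠ s') (hw : 0 < ⟪s, w⟫) (hw' : 0 < ⟪s', w⟫)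
    (hT : ∀ y ∈ T, 0 ≤ ⟪s, y⟫) (hT' : ∀ y ∈ T, 0 ≤ ⟪s', y⟫) :
    stdGaussian (𝔼 n) (sweep (coneFacet T s) w ∩ sweep (coneFacet T s') w) = 0 := by
  have ha : ⟪s, w⟫⁻¹ • s - ⟪s', w⟫⁻¹ • s' ≠ 0 := by
    intro h
    rw [sub_eq_zero] at h
    have h1 := congrArg norm h
    rw [norm_smul, norm_smul, hs, hs', mul_one, mul_one, Real.norm_of_nonneg (by positivity),
      Real.norm_of_nonneg (by positivity)] at h1
    rw [h1] at h
    exact hne (smul_right_injective _ (inv_pos.2 hw').ne' h)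
  refine measure_mono_null ?_ (stdGaussian_hyperplane ha)
  rintro y ⟨⟨t, -, hy, hys⟩, ⟨t', -, hy', hys'⟩⟩
  have h1 := hT _ hy'
  have h2 := hT' _ hy
  rw [inner_sub_right, inner_smul_right] at hys hys' h1 h2
  have htt : t = t' := by
    refine le_antisymm ?_ ?_
    · exact le_of_mul_le_mul_right (by linarith) hw'
    · exact le_of_mul_le_mul_right (by linarith) hw
  subst htt
  have e1 : ⟪s, y⟫ = t * ⟪s, w⟫ := by linarith
  have e2 : ⟪s', y⟫ = t * ⟪s', w⟫ := by linarith
  change ⟪_, y⟫ = (0 : ℝ)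
  rw [inner_sub_left, real_inner_smul_left, real_inner_smul_left, e1, e2]
  field_simp
  ring

/-- Adding `t • w ∈ T` stays in `T`, whereas `⟪s, y - w⟫ = (t - 1) ⟪s, w⟫ < 0`; this needs `t < 1`
strictly. -/
theorem sweep_subset_margin {s w : 𝔼 n} (hT : ∀ y ∈ T, 0 ≤ ⟪s, y⟫) (hwT : w ∈ T)
    (hw : 0 < ⟪s, w⟫) : sweep (coneFacet (T : Set (𝔼 n)) s) w ⊆ margin (T : Set (𝔼 n)) w := by
  rintro y ⟨t, ht, hy, hys⟩
  refine mem_margin_iff.2 ⟨?_, fun h ↦ ?_⟩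
  · rw [← sub_add_cancel y (t • w)]
    exact T.add_mem hy (T.smul_mem ht.1 hwT)
  · have h1 := hT _ h
    rw [inner_sub_right] at h1
    rw [inner_sub_right, inner_smul_right] at hys
    nlinarith [ht.2]

end Cone

/-! ### Summation over facets and the two bounds -/

theorem marginFunctional_eq_sum_filter {n ℓ : ℕ} (T : Set (EuclideanSpace ℝ (Fin n)))
    (s : Fin ℓ → EuclideanSpace ℝ (Fin n)) (w : EuclideanSpace ℝ (Fin n)) :
    marginFunctional T s w = ∑ i with 0 < ⟪s i, w⟫,
      (√(2 * Real.pi))⁻¹ * (relGaussianMeas (coneFacet T (s i)) * ⟪s i, w⟫) := by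
  rw [marginFunctional, Finset.mul_sum, Finset.sum_filter]
  refine Finset.sum_congr rfl fun i _ ↦ ?_
  split_ifs with h
  · rw [max_eq_right h.le]
  · rw [max_eq_left (not_lt.1 h), mul_zero, mul_zero]

theorem marginFunctional_nonneg {n ℓ : ℕ} (T : Set (EuclideanSpace ℝ (Fin n)))
    (s : Fin ℓ → EuclideanSpace ℝ (Fin n)) (w : EuclideanSpace ℝ (Fin n)) :
    0 ≤ marginFunctional T s w :=
  mul_nonneg (by positivity) (Finset.sum_nonneg fun _ _ ↦
    mul_nonneg measureReal_nonneg (le_max_left _ _))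

theorem gaussianMeas_margin_le {n ℓ : ℕ} {T : PointedCone ℝ (EuclideanSpace ℝ (Fin n))}
    (hT : T.DualFG (innerₗ (EuclideanSpace ℝ (Fin n)))) {s : Fin ℓ → EuclideanSpace ℝ (Fin n)}
    (hs : Set.range s = facetNormals (T : Set (EuclideanSpace ℝ (Fin n))))
    (w : EuclideanSpace ℝ (Fin n)) :
    gaussianMeas (margin (T : Set (EuclideanSpace ℝ (Fin n))) w) ≤
      marginFunctional (T : Set (EuclideanSpace ℝ (Fin n))) s w *
        Real.exp (√((n : ℝ) - 1) * ‖w‖) := by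
  classical
  have hclosed := isClosed_of_dualFG hT
  obtain ⟨A, hA⟩ := hT
  set T' := (T : Set (EuclideanSpace ℝ (Fin n)))
  set S := fun i ↦ sweep (coneFacet T' (s i)) w
  -- The description `A` of `T` may contain redundant constraints; those that define no facet are
  -- collected in `B` and their sweeps in the null set `N`.
  set B := A.filter fun a ↦ 0 < ⟪a, w⟫ ∧ ‖a‖⁻¹ • a ∉ facetNormals T'
  set N := ⋃ a ∈ B, T' ∩ sweep (coneFacet T' a) w
  have hN : stdGaussian _ N = 0 := by
    refine (measure_biUnion_null_iff B.countable_toSet).2 fun a ha ↦ ?_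
    obtain ⟨haA, haw, hna⟩ := Finset.mem_filter.1 ha
    exact stdGaussian_inter_sweep_eq_zero hA haA haw hna
  have hsub : margin T' w ⊆ (⋃ i ∈ ({i | 0 < ⟪s i, w⟫} : Finset (Fin ℓ)), S i) ∪ N := by
    intro y hy
    obtain ⟨a, haA, haw, hya⟩ := exists_mem_sweep_of_mem_margin hA hy
    by_cases hna : ‖a‖⁻¹ • a ∈ facetNormals T'
    · left
      obtain ⟨i, hi⟩ := hs ▸ hna
      have hpos : 0 < ‖a‖⁻¹ := by
        rw [inv_pos, norm_pos_iff]
        rintro rfl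
        simp at haw
      have hF : coneFacet T' (s i) = coneFacet T' a := by
        ext y
        simp [coneFacet, hi, real_inner_smul_left, (inv_pos.1 hpos).ne']
      refine Set.mem_biUnion (x := i) ?_ (by simpa only [S, hF] using hya)
      simp only [Finset.coe_filter, Finset.mem_univ, true_and, Set.mem_ofPred_eq, hi,
        real_inner_smul_left]
      exact mul_pos hpos haw
    · right
      exact Set.mem_biUnion (x := a) (Finset.mem_filter.2 ⟨haA, haw, hna⟩)
        ⟨(mem_margin_iff.1 hy).1, hya⟩
  rw [marginFunctional_eq_sum_filter, Finset.sum_mul]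
  calc gaussianMeas (margin T' w)
      ≤ (stdGaussian _).real ((⋃ i ∈ ({i | 0 < ⟪s i, w⟫} : Finset (Fin ℓ)), S i) ∪ N) :=
        measureReal_mono hsub
    _ ≤ (stdGaussian _).real (⋃ i ∈ ({i | 0 < ⟪s i, w⟫} : Finset (Fin ℓ)), S i) := by
        refine (measureReal_union_le _ _).trans_eq ?_
        rw [measureReal_def (s := N), hN, ENNReal.toReal_zero, add_zero]
    _ ≤ ∑ i with 0 < ⟪s i, w⟫, gaussianMeas (S i) := measureReal_biUnion_finset_le _ _
    _ ≤ _ := by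
        refine Finset.sum_le_sum fun i hi ↦ ?_
        exact gaussianMeas_sweep_coneFacet_le hclosed (hs ▸ Set.mem_range_self i)
          (Finset.mem_filter.1 hi).2

theorem le_gaussianMeas_margin {n ℓ : ℕ} {T : PointedCone ℝ (EuclideanSpace ℝ (Fin n))}
    (hT : T.DualFG (innerₗ (EuclideanSpace ℝ (Fin n)))) {s : Fin ℓ → EuclideanSpace ℝ (Fin n)}
    (hs_inj : Function.Injective s)
    (hs : Set.range s = facetNormals (T : Set (EuclideanSpace ℝ (Fin n))))
    {w : EuclideanSpace ℝ (Fin n)} (hw : w ∈ T) :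
    marginFunctional (T : Set (EuclideanSpace ℝ (Fin n))) s w *
        Real.exp (-√((n : ℝ) - 1) * ‖w‖ - 1 / 2 * ‖w‖ ^ 2) ≤
      gaussianMeas (margin (T : Set (EuclideanSpace ℝ (Fin n))) w) := by
  have hclosed := isClosed_of_dualFG hT
  have hsi : ∀ i, s i ∈ facetNormals (T : Set (EuclideanSpace ℝ (Fin n))) :=
    fun i ↦ hs ▸ Set.mem_range_self i
  set T' := (T : Set (EuclideanSpace ℝ (Fin n)))
  set S := fun i ↦ sweep (coneFacet T' (s i)) w
  rw [marginFunctional_eq_sum_filter, Finset.sum_mul]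
  calc _ ≤ ∑ i with 0 < ⟪s i, w⟫, gaussianMeas (S i) :=
        Finset.sum_le_sum fun i hi ↦
          le_gaussianMeas_sweep_coneFacet hclosed (hsi i) (Finset.mem_filter.1 hi).2
    _ = (stdGaussian _).real (⋃ i ∈ ({i | 0 < ⟪s i, w⟫} : Finset (Fin ℓ)), S i) := by
        rw [measureReal_def, measure_biUnion_finset₀, ENNReal.toReal_sum (by finiteness)]
        · rfl
        · intro i hi j hj hij
          exact stdGaussian_sweep_inter_sweep (hsi i).1 (hsi j).1 (hs_inj.ne hij)
            (Finset.mem_filter.1 hi).2 (Finset.mem_filter.1 hj).2 (hsi i).2.1 (hsi j).2.1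
        · intro i hi
          exact (measurableSet_sweep (measurableSet_coneFacet hclosed (s i)) (fun y hy ↦ hy.2)
            (Finset.mem_filter.1 hi).2).nullMeasurableSet
    _ ≤ gaussianMeas (margin T' w) :=
        measureReal_mono (Set.iUnion₂_subset fun i hi ↦
          sweep_subset_margin (hsi i).2.1 hw (Finset.mem_filter.1 hi).2)

theorem mainTheorem8 {n ℓ : ℕ}
    (T : PointedCone ℝ (EuclideanSpace ℝ (Fin n)))
    -- `T` is polyhedral: an intersection of finitely many half-spaces `{y | 0 ≤ a · y}`
    (hT : T.DualFG (innerₗ (EuclideanSpace ℝ (Fin n))))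
    -- `s 0, …, s (ℓ - 1)` lists the inward unit normals of the facets of `T` without repetition
    (s : Fin ℓ → EuclideanSpace ℝ (Fin n))
    (hs_inj : Function.Injective s)
    (hs : Set.range s = facetNormals (T : Set (EuclideanSpace ℝ (Fin n))))
    (w : EuclideanSpace ℝ (Fin n)) :
    gaussianMeas (margin (T : Set (EuclideanSpace ℝ (Fin n))) w) ≤
        2 * marginFunctional (T : Set (EuclideanSpace ℝ (Fin n))) s w *
          Real.exp (√((n : ℝ) - 1) * ‖w‖) ∧
      (w ∈ T →
        marginFunctional (T : Set (EuclideanSpace ℝ (Fin n))) s w *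
            Real.exp (-√((n : ℝ) - 1) * ‖w‖ - 1 / 2 * ‖w‖ ^ 2) ≤
          gaussianMeas (margin (T : Set (EuclideanSpace ℝ (Fin n))) w)) := by
  -- The upper bound holds without the factor 2, which is pure slack because the functional is
  -- nonnegative.
  refine ⟨(gaussianMeas_margin_le hT hs w).trans ?_, le_gaussianMeas_margin hT hs_inj hs⟩
  have := marginFunctional_nonneg (T : Set (EuclideanSpace ℝ (Fin n))) s w
  gcongr
  linarith
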